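/- Let $\mathcal X$ be a complex linear space and $\varphi=\{\varphi_k\}_{k=1}^\infty$ a linearly independent system in it. Suppose a number $(x,y)\in\mathbb C$ is given for all $x,y\in\mathcal X$ at least one of which belongs to $\varphi$, such that $(x,y)=\overline{(y,x)}$, $(\lambda x_1+\mu x_2,y)=\lambda(x_1,y)+\mu(x_2,y)$, and $(\varphi_k,\varphi_l)=1$ if $k=l$, $0$ otherwise. Put $\hat x(k)=(x,\varphi_k)$. For $p\in[1,\infty)$ let $\mathcal S^p_\varphi$ be the normed space of all $x\in\mathcal X$ with $$\|x\|_p=\Big(\sum_{k=1}^\infty|\hat x(k)|^p\Big)^{1/p}<\infty,$$ where elements with the same coefficients $\hat x(k)$ are identified, and let $U^p_\varphi$ be its closed unit ball. Let $\psi=\{\psi_k\}_{k=1}^\infty$ be complex numbers with $\lim_{k\to\infty}|\psi_k|=0$ and $\psi_k\ne0$ for all $k$. Let $\psi U^p_\varphi$ be the set of all $F\in\mathcal X$ for which there is $f\in U^p_\varphi$ with $\hat F(k)=\psi_k\hat f(k)$ for all $k$. Let $\varepsilon_1>\varepsilon_2>\dots$ be the distinct values of $|\psi_k|$ in decreasing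 order, $g_n=\{k\in\mathbb N:|\psi_k|\ge\varepsilon_n\}$ and $\delta_n=|g_n|$ for $n\ge1$, and $g_0=\emptyset$, $\delta_0=0$. For $m\ge0$ let $$d_m(\psi U^p_\varphi)=\inf_{F_m}\ \sup_{x\in\psi U^p_\varphi}\ \inf_{u\in F_m}\|x-u\|_p,$$ where $F_m$ ranges over the $m$-dimensional linear subspaces of $\mathcal S^p_\varphi$ (Kolmogorov width), and for $n\ge1$ let $$E_n(\psi U^p_\varphi)_{\psi,p}=\sup_{f\in\psi U^p_\varphi}\ \inf_{c_k\in\mathbb C}\Big\|f-\sum_{k\in g_{n-1}}c_k\varphi_k\Big\|_p,\qquad \mathcal E_n(\psi U^p_\varphi)_{\psi,p}=\sup_{f\in\psi U^p_\varphi}\Big\|f-\sum_{k\in g_{n-1}}\hat f(k)\varphi_k\Big\|_p .$$ **Theorem 2.7.** For every $p\in[1,\infty)$ and every $n\in\mathbb N$, $n\ge1$, $$d_{\delta_{n-1}}(\psi U^p_\varphi)=d_{\delta_{n-1}+1}(\psi U^p_\varphi)=\dots=d_{\delta_n-1}(\psi U^p_\varphi)=E_n(\psi U^p_\varphi)_{\psi,p}=\mathcal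 E_n(\psi U^p_\varphi)_{\psi,p}=\varepsilon_n .$$ -/

import Mathlib

open Filter Topology
open scoped ENNReal

noncomputable section

/-- A countable linearly independent system `φ` in a complex linear space `X` (indexed here by
`ℕ` starting from `0`), together with a scalar product of the elements of `X` with the elements of
`φ`. Only the values `ip x y` for which `x` or `y` belongs to the system are
constrained (and only these are ever used). -/
structure PhiSystem (X : Type*) [AddCommGroup X] [Module ℂ X] where
  φ : ℕ → X
  linearIndependent : LinearIndependent ℂ φ
  ip : X → X → ℂ
  ip_conj_symm : ∀ x y : X, (x ∈ Set.range φ ∨ y ∈ Set.range φ) →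
    ip x y = (starRingEnd ℂ) (ip y x)
  ip_linear : ∀ (a b : ℂ) (x₁ x₂ y : X), y ∈ Set.range φ →
    ip (a • x₁ + b • x₂) y = a * ip x₁ y + b * ip x₂ y
  ip_orthonormal : ∀ k l : ℕ, ip (φ k) (φ l) = if k = l then 1 else 0

namespace PhiSystem

variable {X : Type*} [AddCommGroup X] [Module ℂ X]

/-- The Fourier coefficient of `x` with number `k`. -/
def coeff (Φ : PhiSystem X) (x : X) (k : ℕ) : ℂ := Φ.ip x (Φ.φ k)

theorem coeff_add (Φ : PhiSystem X) (x y : X) (k : ℕ) :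
    Φ.coeff (x + y) k = Φ.coeff x k + Φ.coeff y k := by
  simpa [coeff] using Φ.ip_linear 1 1 x y (Φ.φ k) ⟨k, rfl⟩

theorem coeff_smul (Φ : PhiSystem X) (a : ℂ) (x : X) (k : ℕ) :
    Φ.coeff (a • x) k = a * Φ.coeff x k := by
  simpa [coeff] using Φ.ip_linear a 0 x 0 (Φ.φ k) ⟨k, rfl⟩

theorem coeff_zero (Φ : PhiSystem X) (k : ℕ) : Φ.coeff 0 k = 0 := by
  simpa using Φ.coeff_smul 0 0 k

/-- The elements of `X` whose Fourier coefficients are `p`-summable (before identification of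
elements with the same coefficients). -/
def Sp (Φ : PhiSystem X) (p : ℝ) [hp : Fact (1 ≤ p)] : Submodule ℂ X where
  carrier := {x | Summable fun k => ‖Φ.coeff x k‖ ^ p}
  add_mem' := by
    intro x y hx hy
    have hp0 : (0 : ℝ) ≤ p := zero_le_one.trans hp.out
    refine Summable.of_nonneg_of_le (fun k => by positivity) (fun k => ?_)
      (Real.Lp_add_le_tsum_of_nonneg hp.out (fun k => norm_nonneg (Φ.coeff x k))
        (fun k => norm_nonneg (Φ.coeff y k)) hx hy).1
    rw [Φ.coeff_add]
    exact Real.rpow_le_rpow (norm_nonneg _) (norm_add_le _ _) hp0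
  zero_mem' := by
    have hp0 : p ≠ 0 := (zero_lt_one.trans_le hp.out).ne'
    simp [coeff_zero, Real.zero_rpow hp0, summable_zero]
  smul_mem' := by
    intro a x hx
    have hx' : Summable fun k => ‖Φ.coeff x k‖ ^ p := hx
    simpa [coeff_smul, Real.mul_rpow] using hx'.mul_left (‖a‖ ^ p)

variable (Φ : PhiSystem X) (p : ℝ) [hp : Fact (1 ≤ p)]

/-- `‖x‖_p = (∑ |x̂(k)|^p)^{1/p}`. -/
instance : Norm (Φ.Sp p) := ⟨fun x => (∑' k, ‖Φ.coeff (x : X) k‖ ^ p) ^ (1 / p)⟩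

theorem norm_def (x : Φ.Sp p) : ‖x‖ = (∑' k, ‖Φ.coeff (x : X) k‖ ^ p) ^ (1 / p) := rfl

theorem Sp_core : SeminormedSpace.Core ℂ (Φ.Sp p) where
  norm_nonneg x := by
    rw [norm_def]; positivity
  norm_smul a x := by
    have hp0 : p ≠ 0 := (zero_lt_one.trans_le hp.out).ne'
    simp only [norm_def, Submodule.coe_smul, coeff_smul, norm_mul,
      Real.mul_rpow (norm_nonneg _) (norm_nonneg _), tsum_mul_left]
    rw [Real.mul_rpow (by positivity) (by positivity), ← Real.rpow_mul (norm_nonneg _),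
      mul_one_div_cancel hp0, Real.rpow_one]
  norm_triangle x y := by
    have hp0 : (0 : ℝ) ≤ p := zero_le_one.trans hp.out
    have h := Real.Lp_add_le_tsum_of_nonneg hp.out (fun k => norm_nonneg (Φ.coeff (x : X) k))
        (fun k => norm_nonneg (Φ.coeff (y : X) k)) x.2 y.2
    refine le_trans ?_ h.2
    refine Real.rpow_le_rpow (by positivity) ?_ (by positivity)
    refine Summable.tsum_le_tsum (fun k => ?_) (x + y).2 h.1
    rw [Submodule.coe_add, Φ.coeff_add]
    exact Real.rpow_le_rpow (norm_nonneg _) (norm_add_le _ _) hp0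

instance : SeminormedAddCommGroup (Φ.Sp p) := SeminormedAddCommGroup.ofCore (Φ.Sp_core p)

instance : NormedSpace ℂ (Φ.Sp p) := { norm_smul_le := fun a x => ((Φ.Sp_core p).norm_smul a x).le }

/-- The normed space `𝒮^p_φ`: the elements of `Sp`, where two elements at distance `0` (that is,
with the same Fourier coefficients, see `mk_eq_mk_iff`) are identified. -/
abbrev SSpace : Type _ := SeparationQuotient (Φ.Sp p)

theorem mk_eq_mk_iff (x y : Φ.Sp p) :
    (SeparationQuotient.mk x : Φ.SSpace p) = SeparationQuotient.mk y ↔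
      ∀ k, Φ.coeff (x : X) k = Φ.coeff (y : X) k := by
  have hp0 : p ≠ 0 := (zero_lt_one.trans_le hp.out).ne'
  rw [SeparationQuotient.mk_eq_mk, Metric.inseparable_iff, dist_eq_norm, norm_def,
    Real.rpow_eq_zero (tsum_nonneg fun k => by positivity) (one_div_ne_zero hp0)]
  have hs : ∀ k, Φ.coeff ((x - y : Φ.Sp p) : X) k
      = Φ.coeff (x : X) k - Φ.coeff (y : X) k := by
    intro k
    have h : ((x - y : Φ.Sp p) : X) = (x : X) + (-1 : ℂ) • (y : X) := by
      simp [sub_eq_add_neg]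
    rw [h, coeff_add, coeff_smul]
    ring
  have hsum : Summable fun k => ‖Φ.coeff ((x - y : Φ.Sp p) : X) k‖ ^ p := (x - y).2
  rw [← hsum.hasSum_iff, hasSum_zero_iff_of_nonneg (fun k => by positivity), funext_iff]
  refine forall_congr' fun k => ?_
  simp only [Pi.zero_apply, Real.rpow_eq_zero (norm_nonneg _) hp0, norm_eq_zero, hs, sub_eq_zero]

theorem phi_mem (k : ℕ) : Φ.φ k ∈ Φ.Sp p := by
  have hp0 : p ≠ 0 := (zero_lt_one.trans_le hp.out).ne'
  refine summable_of_ne_finset_zero (s := {k}) fun l hl => ?_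
  have : k ≠ l := fun h => hl (by simp [h])
  simp [coeff, Φ.ip_orthonormal, this, Real.zero_rpow hp0]

/-- The element `φ_k` as an element of `Sp`. -/
def phi (k : ℕ) : Φ.Sp p := ⟨Φ.φ k, Φ.phi_mem p k⟩

/-- The unit ball `U^p_φ`. -/
def unitBall : Set (Φ.Sp p) := {f | ‖f‖ ≤ 1}

/-- `F` is a `ψ`-integral of `f`. -/
def IsPsiIntegral (ψ : ℕ → ℂ) (F f : X) : Prop := ∀ k, Φ.coeff F k = ψ k * Φ.coeff f k

/-- The set `ψU^p_φ` of the `ψ`-integrals of the elements of the unit ball. (For bounded `ψ` every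
`ψ`-integral `F ∈ X` of an element of `Sp` belongs to `Sp`, see `IsPsiIntegral.mem_Sp`.) -/
def psiBall (ψ : ℕ → ℂ) : Set (Φ.Sp p) :=
  {F | ∃ f ∈ Φ.unitBall p, Φ.IsPsiIntegral ψ (F : X) (f : X)}

theorem IsPsiIntegral.mem_Sp {ψ : ℕ → ℂ} {C : ℝ} (hC : ∀ k, ‖ψ k‖ ≤ C) {F f : X}
    (hf : f ∈ Φ.Sp p) (h : Φ.IsPsiIntegral ψ F f) : F ∈ Φ.Sp p := by
  have hp0 : (0 : ℝ) ≤ p := zero_le_one.trans hp.out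
  have hf' : Summable fun k => ‖Φ.coeff f k‖ ^ p := hf
  refine Summable.of_nonneg_of_le (fun k => by positivity) (fun k => ?_) (hf'.mul_left (C ^ p))
  rw [h k, norm_mul, Real.mul_rpow (norm_nonneg _) (norm_nonneg _)]
  gcongr
  exact hC k

/-- The set `ψU^p_φ` as a subset of the normed space `𝒮^p_φ`. -/
def psiBallS (ψ : ℕ → ℂ) : Set (Φ.SSpace p) := SeparationQuotient.mk '' Φ.psiBall p ψ

end PhiSystem

/-- The characteristic sequence `ε_1 > ε_2 > …` of `ψ`: the values of `|ψ_k|` in decreasing order: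
`ε_1` is the largest of them, `ε_{n+1}` the largest of those below `ε_n`. The value at `0` is
not used. -/
def charEps (ψ : ℕ → ℂ) : ℕ → ℝ
  | 0 => 0
  | 1 => sSup {t | ∃ k, ‖ψ k‖ = t}
  | n + 2 => sSup {t | (∃ k, ‖ψ k‖ = t) ∧ t < charEps ψ (n + 1)}

/-- The characteristic sequence `g_n = {k : |ψ_k| ≥ ε_n}`, `g_0 = ∅`. -/
def charSet (ψ : ℕ → ℂ) (n : ℕ) : Set ℕ :=
  if n = 0 then ∅ else {k | charEps ψ n ≤ ‖ψ k‖}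

/-- The characteristic sequence `δ_n`, the number of elements of `g_n`. -/
def charDelta (ψ : ℕ → ℂ) (n : ℕ) : ℕ := (charSet ψ n).ncard

/-- The Kolmogorov width `d_m(M; Y)`; the infimum is over the subspaces of dimension exactly `m`. -/
def kolmogorovWidth {Y : Type*} [NormedAddCommGroup Y] [NormedSpace ℂ Y] (M : Set Y) (m : ℕ) :
    ℝ≥0∞ :=
  ⨅ (F : Submodule ℂ Y) (_ : FiniteDimensional ℂ F ∧ Module.finrank ℂ F = m),
    ⨆ x ∈ M, ⨅ u : F, ‖x - (u : Y)‖ₑ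

namespace PhiSystem

variable {X : Type*} [AddCommGroup X] [Module ℂ X]

variable (Φ : PhiSystem X) (p : ℝ) [hp : Fact (1 ≤ p)]

/-- `E_n(f)_{ψ,p}`: the best approximation of `f` by polynomials with numbers in `g_{n-1}(ψ)`. -/
def bestApprox (ψ : ℕ → ℂ) (n : ℕ) (f : Φ.Sp p) : ℝ≥0∞ :=
  ⨅ c : ℕ → ℂ, ‖f - ∑ᶠ k ∈ charSet ψ (n - 1), c k • Φ.phi p k‖ₑ

/-- The deviation of `f` from its Fourier sum over `g_{n-1}(ψ)`. -/
def fourierApprox (ψ : ℕ → ℂ) (n : ℕ) (f : Φ.Sp p) : ℝ≥0∞ :=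
  ‖f - ∑ᶠ k ∈ charSet ψ (n - 1), Φ.coeff (f : X) k • Φ.phi p k‖ₑ

/-- Supremum of `bestApprox` over a set. -/
def bestApproxOn (ψ : ℕ → ℂ) (n : ℕ) (M : Set (Φ.Sp p)) : ℝ≥0∞ :=
  ⨆ f ∈ M, Φ.bestApprox p ψ n f

/-- Supremum of `fourierApprox` over a set. -/
def fourierApproxOn (ψ : ℕ → ℂ) (n : ℕ) (M : Set (Φ.Sp p)) : ℝ≥0∞ :=
  ⨆ f ∈ M, Φ.fourierApprox p ψ n f

end PhiSystem

end

/-!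
The theorem is the chain of inequalities `ε_n ≤ d_m ≤ d_{δ_{n-1}} ≤ E_n ≤ 𝓔_n ≤ ε_n` for
`δ_{n-1} ≤ m < δ_n`.

The Fourier sum over `g_{n-1}` removes exactly the coefficients with `|ψ_k| > ε_n`, which gives the
last inequality; the polynomials over `g_{n-1}` form a subspace of dimension `δ_{n-1}`, which gives
`d_{δ_{n-1}} ≤ E_n`. For the first inequality, let `L` be the space of polynomials over `g_n`, of
dimension `δ_n > m`. The set `ψU^p_φ` contains the ball of radius `ε_n` of `L`, and the Fourier sum
over `g_n` is a projection onto `L` that does not increase the norm. It maps a subspace `F` of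
dimension `m` onto a proper subspace of `L`, and a vector `z` of `L` whose nearest point in this
image is `0` has distance `‖z‖` from `F`.
-/

section KolmogorovWidth

theorem exists_norm_eq_forall_mem_le_norm_sub {𝕜 E : Type*} [RCLike 𝕜] [NormedAddCommGroup E]
    [NormedSpace 𝕜 E] [ProperSpace E] {G : Submodule 𝕜 E} (hG : IsClosed (G : Set E))
    (hG_top : G ≠ ⊤) {ε : ℝ} (hε : 0 < ε) :
    ∃ z : E, ‖z‖ = ε ∧ ∀ u ∈ G, ε ≤ ‖z - u‖ := by
  obtain ⟨x, hx⟩ : ∃ x, x ∉ G := by simpa [Submodule.eq_top_iff'] using hG_top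
  obtain ⟨g, hg, hxg⟩ := hG.exists_infDist_eq_dist G.nonempty x
  have hpos : 0 < ‖x - g‖ := norm_pos_iff.2 (sub_ne_zero.2 fun h => hx (h ▸ hg))
  have hnearest : ∀ u ∈ G, ‖x - g‖ ≤ ‖x - g - u‖ := fun u hu => by
    rw [sub_sub, ← dist_eq_norm, ← dist_eq_norm, ← hxg]
    exact Metric.infDist_le_dist_of_mem (G.add_mem hg hu)
  set a : 𝕜 := ((ε / ‖x - g‖ : ℝ) : 𝕜)
  have ha : ‖a‖ = ε / ‖x - g‖ := RCLike.norm_of_nonneg (by positivity)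
  have ha0 : a ≠ 0 := norm_pos_iff.1 (ha ▸ div_pos hε hpos)
  have hnorm : ‖a‖ * ‖x - g‖ = ε := by rw [ha, div_mul_cancel₀ _ hpos.ne']
  refine ⟨a • (x - g), by rw [norm_smul, hnorm], fun u hu => ?_⟩
  calc ε = ‖a‖ * ‖x - g‖ := hnorm.symm
    _ ≤ ‖a‖ * ‖x - g - a⁻¹ • u‖ := by gcongr; exact hnearest _ (G.smul_mem _ hu)
    _ = ‖a • (x - g) - u‖ := by rw [← norm_smul, smul_sub, smul_inv_smul₀ ha0]

variable {Y : Type*} [NormedAddCommGroup Y] [NormedSpace ℂ Y]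

theorem kolmogorovWidth_antitone (hY : ¬ FiniteDimensional ℂ Y) (M : Set Y) :
    Antitone (kolmogorovWidth M) := by
  refine antitone_nat_of_succ_le fun m => le_iInf₂ fun F ⟨hF, hFm⟩ => ?_
  obtain ⟨x, hx⟩ : ∃ x, x ∉ F := by
    by_contra! h
    exact hY (Module.finite_def.2 (Submodule.eq_top_iff'.2 h ▸ Module.Finite.iff_fg.1 hF))
  have hdim : Module.finrank ℂ ↥(F ⊔ ℂ ∙ x) = m + 1 := by
    have h := Submodule.finrank_sup_add_finrank_inf_eq F (ℂ ∙ x)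
    rwa [(Submodule.disjoint_span_singleton_of_notMem hx).eq_bot, finrank_bot, add_zero, hFm,
      finrank_span_singleton fun h0 : x = 0 => hx (h0 ▸ F.zero_mem)] at h
  refine iInf₂_le_of_le (F ⊔ ℂ ∙ x) ⟨inferInstance, hdim⟩ (iSup₂_mono fun y _ => ?_)
  exact le_iInf fun u => iInf_le_of_le ⟨u, Submodule.mem_sup_left u.2⟩ le_rfl

theorem le_kolmogorovWidth_of_isProj {L : Submodule ℂ Y} {P : Y →ₗ[ℂ] Y} (hP : LinearMap.IsProj L P)
    (hP_norm : ∀ y, ‖P y‖ ≤ ‖y‖) {M : Set Y} {ε : ℝ} (hM : ∀ z ∈ L, ‖z‖ ≤ ε → z ∈ M) {m : ℕ}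
    (hm : m < Module.finrank ℂ L) : ENNReal.ofReal ε ≤ kolmogorovWidth M m := by
  obtain hε | hε := le_or_gt ε 0
  · simp [ENNReal.ofReal_of_nonpos hε]
  refine le_iInf₂ fun F ⟨_, hFm⟩ => ?_
  have : FiniteDimensional ℂ L := Module.finite_of_finrank_pos (by omega)
  have : ProperSpace L := FiniteDimensional.proper ℂ L
  set G : Submodule ℂ L := F.map hP.codRestrict
  have hG_top : G ≠ ⊤ := fun h => by
    have hGm : Module.finrank ℂ G ≤ m := hFm ▸ Submodule.finrank_map_le _ F
    rw [h, finrank_top] at hGm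
    exact hm.not_ge hGm
  obtain ⟨z, hzε, hz⟩ :=
    exists_norm_eq_forall_mem_le_norm_sub G.closed_of_finiteDimensional hG_top hε
  refine le_iSup₂_of_le (z : Y) (hM z z.2 hzε.le) (le_iInf fun u => ?_)
  rw [← ofReal_norm]
  refine ENNReal.ofReal_le_ofReal ?_
  calc ε ≤ ‖z - hP.codRestrict u‖ := hz _ (Submodule.mem_map_of_mem u.2)
    _ = ‖P (z - u)‖ := by
      rw [Submodule.coe_norm, Submodule.coe_sub, hP.codRestrict_apply, map_sub, hP.map_id z z.2]
    _ ≤ ‖(z : Y) - u‖ := hP_norm _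

end KolmogorovWidth

section CharacteristicSequences

variable {ψ : ℕ → ℂ} {n : ℕ}

theorem notMem_charSet_iff {k : ℕ} : k ∉ charSet ψ n ↔ (n ≠ 0 → ‖ψ k‖ < charEps ψ n) := by
  by_cases h : n = 0 <;> simp [charSet, h]

theorem charEps_le_norm_of_mem_charSet {k : ℕ} (hk : k ∈ charSet ψ n) : charEps ψ n ≤ ‖ψ k‖ := by
  contrapose! hk
  exact notMem_charSet_iff.2 fun _ => hk

theorem charEps_succ (ψ : ℕ → ℂ) (n : ℕ) :
    charEps ψ (n + 1) = sSup ((fun k => ‖ψ k‖) '' (charSet ψ n)ᶜ) := by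
  cases n with
  | zero => simp [charEps, charSet, Set.range]
  | succ n =>
    rw [charEps]
    congr 1
    ext t
    simp only [Set.mem_image, Set.mem_compl_iff, notMem_charSet_iff]
    aesop

theorem charSet_subset_succ (ψ : ℕ → ℂ) (n : ℕ) : charSet ψ n ⊆ charSet ψ (n + 1) := by
  intro k hk
  have hn : n ≠ 0 := by rintro rfl; simp [charSet] at hk
  suffices h : charEps ψ (n + 1) ≤ ‖ψ k‖ by simpa [charSet] using h
  rw [charEps_succ]
  refine Real.sSup_le ?_ (norm_nonneg _)
  rintro _ ⟨j, hj, rfl⟩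
  exact (notMem_charSet_iff.1 hj hn).le.trans (charEps_le_norm_of_mem_charSet hk)

variable (hψ : Tendsto (fun k => ‖ψ k‖) atTop (𝓝 0))

include hψ

theorem norm_le_charEps_succ {k : ℕ} (hk : k ∉ charSet ψ n) : ‖ψ k‖ ≤ charEps ψ (n + 1) := by
  rw [charEps_succ]
  exact le_csSup (hψ.bddAbove_range.mono (Set.image_subset_range _ _)) (Set.mem_image_of_mem _ hk)

theorem finite_charSet (hε : 0 < charEps ψ n) : (charSet ψ n).Finite := by
  have hlt : ∀ᶠ k in cofinite, ‖ψ k‖ < charEps ψ n :=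
    Nat.cofinite_eq_atTop ▸ hψ.eventually_lt_const hε
  exact (eventually_cofinite.1 hlt).subset fun k hk => (charEps_le_norm_of_mem_charSet hk).not_gt

theorem charEps_pos (hψ_ne : ∀ k, ψ k ≠ 0) (hn : n ≠ 0) : 0 < charEps ψ n := by
  induction n with
  | zero => exact absurd rfl hn
  | succ n ih =>
    have hfin : (charSet ψ n).Finite := by
      by_cases h : n = 0
      · simp [h, charSet]
      · exact finite_charSet hψ (ih h)
    obtain ⟨k, hk⟩ := hfin.exists_notMem
    exact (norm_pos_iff.2 (hψ_ne k)).trans_le (norm_le_charEps_succ hψ hk)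

theorem charSet_ssubset_succ (hε : 0 < charEps ψ (n + 1)) : charSet ψ n ⊂ charSet ψ (n + 1) := by
  rw [charEps_succ] at hε
  obtain ⟨k, hk, hk0⟩ : ∃ k ∉ charSet ψ n, 0 < ‖ψ k‖ := by
    by_contra! h
    exact hε.not_ge (Real.sSup_nonpos (by rintro _ ⟨k, hk, rfl⟩; exact h k hk))
  obtain ⟨j, hj, hmax⟩ : ∃ j ∈ (charSet ψ n)ᶜ, IsMaxOn (fun k => ‖ψ k‖) (charSet ψ n)ᶜ j := by
    refine continuous_of_discreteTopology.continuousOn.exists_isMaxOn' (isClosed_discrete _) hk ?_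
    rw [cocompact_eq_cofinite, Nat.cofinite_eq_atTop]
    exact (hψ.eventually_le_const hk0).filter_mono inf_le_left
  have hle : charEps ψ (n + 1) ≤ ‖ψ j‖ := by
    rw [charEps_succ]
    exact Real.sSup_le (by rintro _ ⟨i, hi, rfl⟩; exact hmax hi) (norm_nonneg _)
  exact ⟨charSet_subset_succ ψ n, fun h => hj (h (by simpa [charSet] using hle))⟩

theorem charDelta_lt_succ (hε : 0 < charEps ψ (n + 1)) : charDelta ψ n < charDelta ψ (n + 1) :=
  Set.ncard_lt_ncard (charSet_ssubset_succ hψ hε) (finite_charSet hψ hε)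

end CharacteristicSequences

namespace PhiSystem

variable {X : Type*} [AddCommGroup X] [Module ℂ X] (Φ : PhiSystem X) (p : ℝ) [hp : Fact (1 ≤ p)]

/-- The Fourier coefficient with number `k` as a linear functional on `𝒮^p_φ`. -/
noncomputable def coeffₗ (k : ℕ) : Φ.SSpace p →ₗ[ℂ] ℂ where
  toFun := SeparationQuotient.lift (fun x : Φ.Sp p => Φ.coeff (x : X) k)
    fun x y h => (Φ.mk_eq_mk_iff p x y).1 (SeparationQuotient.mk_eq_mk.2 h) k
  map_add' := SeparationQuotient.surjective_mk.forall₂.2 fun _ _ => Φ.coeff_add _ _ k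
  map_smul' a := SeparationQuotient.surjective_mk.forall.2 fun _ => Φ.coeff_smul a _ k

/-- The class of `φ_k` in `𝒮^p_φ`. -/
noncomputable def phiS (k : ℕ) : Φ.SSpace p := SeparationQuotient.mk (Φ.phi p k)

/-- The `φ`-polynomials with numbers in `s`, as a subspace of `𝒮^p_φ`. -/
noncomputable def polynomials (s : Set ℕ) : Submodule ℂ (Φ.SSpace p) :=
  Submodule.span ℂ (Φ.phiS p '' s)

/-- The Fourier sum `∑_{k ∈ s} x̂(k) φ_k`, as a linear operator on `𝒮^p_φ`. -/
noncomputable def fourierSum (s : Finset ℕ) : Φ.SSpace p →ₗ[ℂ] Φ.SSpace p :=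
  ∑ k ∈ s, (Φ.coeffₗ p k).smulRight (Φ.phiS p k)

variable {Φ p}

theorem coeffₗ_mk (k : ℕ) (x : Φ.Sp p) :
    Φ.coeffₗ p k (SeparationQuotient.mk x) = Φ.coeff (x : X) k := rfl

theorem ext_coeffₗ {x y : Φ.SSpace p} (h : ∀ k, Φ.coeffₗ p k x = Φ.coeffₗ p k y) : x = y := by
  obtain ⟨x, rfl⟩ := SeparationQuotient.surjective_mk x
  obtain ⟨y, rfl⟩ := SeparationQuotient.surjective_mk y
  exact (Φ.mk_eq_mk_iff p x y).2 h

theorem norm_le_mul_of_norm_coeffₗ_le {x y : Φ.SSpace p} {A : ℝ} (hA : 0 ≤ A)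
    (h : ∀ k, ‖Φ.coeffₗ p k x‖ ≤ A * ‖Φ.coeffₗ p k y‖) : ‖x‖ ≤ A * ‖y‖ := by
  have hp0 : 0 ≤ p := zero_le_one.trans hp.out
  obtain ⟨x, rfl⟩ := SeparationQuotient.surjective_mk x
  obtain ⟨y, rfl⟩ := SeparationQuotient.surjective_mk y
  have hAy : ‖(A : ℂ) • y‖ = A * ‖y‖ := by rw [norm_smul, Complex.norm_of_nonneg hA]
  rw [SeparationQuotient.norm_mk, SeparationQuotient.norm_mk, ← hAy, norm_def, norm_def]
  refine Real.rpow_le_rpow (tsum_nonneg fun k => by positivity) ?_ (by positivity)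
  refine Summable.tsum_le_tsum (fun k => ?_) x.2 ((A : ℂ) • y).2
  rw [Submodule.coe_smul, coeff_smul, norm_mul, Complex.norm_of_nonneg hA]
  exact Real.rpow_le_rpow (norm_nonneg _) (h k) hp0

theorem coeffₗ_phiS (k l : ℕ) : Φ.coeffₗ p l (Φ.phiS p k) = if k = l then 1 else 0 :=
  Φ.ip_orthonormal k l

theorem coeffₗ_sum_smul_phiS (s : Finset ℕ) (c : ℕ → ℂ) (l : ℕ) :
    Φ.coeffₗ p l (∑ k ∈ s, c k • Φ.phiS p k) = if l ∈ s then c l else 0 := by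
  simp [coeffₗ_phiS]

theorem linearIndependent_phiS : LinearIndependent ℂ (Φ.phiS p) :=
  .of_pairwise_dual_eq_zero_one _ (Φ.coeffₗ p)
    (fun k l hkl => by simp [coeffₗ_phiS, hkl.symm]) (fun k => by simp [coeffₗ_phiS])

theorem not_finiteDimensional_SSpace : ¬ FiniteDimensional ℂ (Φ.SSpace p) := fun _ =>
  have := (linearIndependent_phiS (Φ := Φ) (p := p)).finite
  not_finite ℕ

theorem finrank_polynomials (s : Finset ℕ) :
    Module.finrank ℂ (Φ.polynomials p s) = s.card := by
  rw [polynomials, Set.image_eq_range, ← Fintype.card_coe]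
  exact finrank_span_eq_card (linearIndependent_phiS.comp _ Subtype.val_injective)

theorem sum_smul_phiS_mem_polynomials (s : Finset ℕ) (c : ℕ → ℂ) :
    ∑ k ∈ s, c k • Φ.phiS p k ∈ Φ.polynomials p s :=
  Submodule.sum_mem _ fun _ hk =>
    Submodule.smul_mem _ _ (Submodule.subset_span (Set.mem_image_of_mem _ hk))

theorem enorm_sub_finsum_smul_phi (f : Φ.Sp p) (s : Finset ℕ) (c : ℕ → ℂ) :
    ‖f - ∑ᶠ k ∈ (s : Set ℕ), c k • Φ.phi p k‖ₑ =
      ‖(SeparationQuotient.mk f : Φ.SSpace p) - ∑ k ∈ s, c k • Φ.phiS p k‖ₑ := by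
  have h_sum : (SeparationQuotient.mk (∑ k ∈ s, c k • Φ.phi p k) : Φ.SSpace p) =
      ∑ k ∈ s, c k • Φ.phiS p k :=
    map_sum (SeparationQuotient.mkCLM ℂ (Φ.Sp p)) (fun k => c k • Φ.phi p k) s
  rw [finsum_mem_coe_finset, ← h_sum, ← SeparationQuotient.mk_sub, ← ofReal_norm, ← ofReal_norm,
    SeparationQuotient.norm_mk]

section FourierSum

variable (s : Finset ℕ)

theorem fourierSum_apply (x : Φ.SSpace p) :
    Φ.fourierSum p s x = ∑ k ∈ s, Φ.coeffₗ p k x • Φ.phiS p k := by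
  simp [fourierSum]

theorem coeffₗ_fourierSum (x : Φ.SSpace p) (l : ℕ) :
    Φ.coeffₗ p l (Φ.fourierSum p s x) = if l ∈ s then Φ.coeffₗ p l x else 0 := by
  rw [fourierSum_apply, coeffₗ_sum_smul_phiS]

theorem norm_fourierSum_le (x : Φ.SSpace p) : ‖Φ.fourierSum p s x‖ ≤ ‖x‖ := by
  rw [← one_mul ‖x‖]
  refine norm_le_mul_of_norm_coeffₗ_le zero_le_one fun l => ?_
  rw [coeffₗ_fourierSum]
  split_ifs <;> simp

theorem isProj_fourierSum : LinearMap.IsProj (Φ.polynomials p s) (Φ.fourierSum p s) where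
  map_mem x := by
    rw [fourierSum_apply]
    exact sum_smul_phiS_mem_polynomials s _
  map_id := by
    suffices h : Φ.polynomials p s ≤ LinearMap.eqLocus (Φ.fourierSum p s) LinearMap.id from h
    rw [polynomials, Submodule.span_le]
    rintro _ ⟨k, hk, rfl⟩
    refine ext_coeffₗ fun l => ?_
    rw [coeffₗ_fourierSum, LinearMap.id_apply, coeffₗ_phiS]
    aesop

end FourierSum

section PsiBall

variable {ψ : ℕ → ℂ}

theorem mem_psiBallS_iff {x : Φ.SSpace p} :
    x ∈ Φ.psiBallS p ψ ↔
      ∃ y : Φ.SSpace p, ‖y‖ ≤ 1 ∧ ∀ k, Φ.coeffₗ p k x = ψ k * Φ.coeffₗ p k y := by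
  constructor
  · rintro ⟨F, ⟨f, hf, hFf⟩, rfl⟩
    exact ⟨SeparationQuotient.mk f, hf, hFf⟩
  · rintro ⟨y, hy, hxy⟩
    obtain ⟨F, rfl⟩ := SeparationQuotient.surjective_mk x
    obtain ⟨f, rfl⟩ := SeparationQuotient.surjective_mk y
    exact ⟨F, ⟨f, hy, hxy⟩, rfl⟩

theorem norm_sub_fourierSum_le {s : Finset ℕ} {ε : ℝ} (hε : 0 ≤ ε) (hs : ∀ k ∉ s, ‖ψ k‖ ≤ ε)
    {x : Φ.SSpace p} (hx : x ∈ Φ.psiBallS p ψ) : ‖x - Φ.fourierSum p s x‖ ≤ ε := by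
  obtain ⟨y, hy, hxy⟩ := mem_psiBallS_iff.1 hx
  calc ‖x - Φ.fourierSum p s x‖ ≤ ε * ‖y‖ := by
        refine norm_le_mul_of_norm_coeffₗ_le hε fun l => ?_
        rw [map_sub, coeffₗ_fourierSum]
        split_ifs with hl
        · simpa using by positivity
        · rw [sub_zero, hxy, norm_mul]
          gcongr
          exact hs l hl
    _ ≤ ε := mul_le_of_le_one_right hε hy

theorem mem_psiBallS_of_mem_polynomials {s : Finset ℕ} {ε : ℝ} (hε : 0 < ε)
    (hs : ∀ k ∈ s, ε ≤ ‖ψ k‖) {x : Φ.SSpace p} (hx : x ∈ Φ.polynomials p s) (hxε : ‖x‖ ≤ ε) :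
    x ∈ Φ.psiBallS p ψ := by
  have hcoeff : ∀ l, Φ.coeffₗ p l x = if l ∈ s then Φ.coeffₗ p l x else 0 := fun l => by
    rw [← coeffₗ_fourierSum, (isProj_fourierSum s).map_id x hx]
  refine mem_psiBallS_iff.2 ⟨∑ k ∈ s, (Φ.coeffₗ p k x / ψ k) • Φ.phiS p k, ?_, fun l => ?_⟩
  · calc ‖∑ k ∈ s, (Φ.coeffₗ p k x / ψ k) • Φ.phiS p k‖ ≤ ε⁻¹ * ‖x‖ := by
          refine norm_le_mul_of_norm_coeffₗ_le (by positivity) fun l => ?_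
          rw [coeffₗ_sum_smul_phiS]
          split_ifs with hl
          · rw [norm_div, div_eq_inv_mul]
            gcongr
            exact hs l hl
          · simpa using by positivity
      _ ≤ 1 := inv_mul_le_one_of_le₀ hxε hε.le
  · rw [coeffₗ_sum_smul_phiS, hcoeff l]
    split_ifs with hl
    · rw [mul_div_cancel₀ _ (norm_pos_iff.1 (hε.trans_le (hs l hl)))]
    · rw [mul_zero]

theorem le_kolmogorovWidth_psiBallS {s : Finset ℕ} {ε : ℝ} (hs : ∀ k ∈ s, ε ≤ ‖ψ k‖) {m : ℕ}
    (hm : m < s.card) : ENNReal.ofReal ε ≤ kolmogorovWidth (Φ.psiBallS p ψ) m := by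
  obtain hε | hε := le_or_gt ε 0
  · simp [ENNReal.ofReal_of_nonpos hε]
  refine le_kolmogorovWidth_of_isProj (isProj_fourierSum s) (norm_fourierSum_le s)
    (fun z => mem_psiBallS_of_mem_polynomials hε hs) ?_
  rwa [finrank_polynomials]

end PsiBall

section Approximation

variable {ψ : ℕ → ℂ} {n : ℕ}

theorem kolmogorovWidth_le_bestApproxOn (hfin : (charSet ψ (n - 1)).Finite) (M : Set (Φ.Sp p)) :
    kolmogorovWidth (SeparationQuotient.mk '' M : Set (Φ.SSpace p)) (charDelta ψ (n - 1)) ≤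
      Φ.bestApproxOn p ψ n M := by
  obtain ⟨s, hs⟩ := hfin.exists_finset_coe
  have hpoly : FiniteDimensional ℂ (Φ.polynomials p s) :=
    FiniteDimensional.span_of_finite ℂ (s.finite_toSet.image _)
  have hdim : Module.finrank ℂ (Φ.polynomials p s) = charDelta ψ (n - 1) := by
    rw [finrank_polynomials, charDelta, ← hs, Set.ncard_coe_finset]
  refine iInf₂_le_of_le _ ⟨hpoly, hdim⟩ (iSup₂_le ?_)
  rintro _ ⟨f, hf, rfl⟩
  refine le_iSup₂_of_le f hf (le_iInf fun c => ?_)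
  rw [← hs, enorm_sub_finsum_smul_phi]
  exact iInf_le_of_le ⟨_, sum_smul_phiS_mem_polynomials s c⟩ le_rfl

theorem bestApproxOn_le_fourierApproxOn (M : Set (Φ.Sp p)) :
    Φ.bestApproxOn p ψ n M ≤ Φ.fourierApproxOn p ψ n M :=
  iSup₂_mono fun f _ => iInf_le _ (Φ.coeff (f : X))

theorem fourierApproxOn_psiBall_le (hfin : (charSet ψ (n - 1)).Finite) {ε : ℝ} (hε : 0 ≤ ε)
    (hψ : ∀ k ∉ charSet ψ (n - 1), ‖ψ k‖ ≤ ε) :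
    Φ.fourierApproxOn p ψ n (Φ.psiBall p ψ) ≤ ENNReal.ofReal ε := by
  refine iSup₂_le fun F hF => ?_
  obtain ⟨s, hs⟩ := hfin.exists_finset_coe
  simp only [← hs, Finset.mem_coe] at hψ
  rw [fourierApprox, ← hs, enorm_sub_finsum_smul_phi, ← ofReal_norm]
  simp only [← coeffₗ_mk, ← fourierSum_apply]
  exact ENNReal.ofReal_le_ofReal (norm_sub_fourierSum_le hε hψ (Set.mem_image_of_mem _ hF))

end Approximation

end PhiSystem

open PhiSystem in
theorem theorem2p7_general {X : Type*} [AddCommGroup X] [Module ℂ X] (Φ : PhiSystem X)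
    (p : ℝ) [Fact (1 ≤ p)] (ψ : ℕ → ℂ)
    (hψ_lim : Tendsto (fun k => ‖ψ k‖) atTop (𝓝 0)) (n : ℕ) (hε : 0 < charEps ψ n) :
    (∀ m : ℕ, charDelta ψ (n - 1) ≤ m → m < charDelta ψ n →
      kolmogorovWidth (Φ.psiBallS p ψ) m = ENNReal.ofReal (charEps ψ n)) ∧
    Φ.bestApproxOn p ψ n (Φ.psiBall p ψ) = ENNReal.ofReal (charEps ψ n) ∧
    Φ.fourierApproxOn p ψ n (Φ.psiBall p ψ) = ENNReal.ofReal (charEps ψ n) := by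
  obtain _ | n := n
  · exact absurd hε (lt_irrefl 0)
  have hfin : (charSet ψ n).Finite := (finite_charSet hψ_lim hε).subset (charSet_subset_succ ψ n)
  have h_width_ge : ∀ m < charDelta ψ (n + 1),
      ENNReal.ofReal (charEps ψ (n + 1)) ≤ kolmogorovWidth (Φ.psiBallS p ψ) m := fun m hm => by
    obtain ⟨s, hs⟩ := (finite_charSet hψ_lim hε).exists_finset_coe
    rw [charDelta, ← hs, Set.ncard_coe_finset] at hm
    exact le_kolmogorovWidth_psiBallS (fun k hk => charEps_le_norm_of_mem_charSet (hs ▸ hk)) hm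
  have h_width_anti := kolmogorovWidth_antitone not_finiteDimensional_SSpace (Φ.psiBallS p ψ)
  have h_width_le := kolmogorovWidth_le_bestApproxOn (n := n + 1) hfin (Φ.psiBall p ψ)
  have h_best_le := bestApproxOn_le_fourierApproxOn (ψ := ψ) (n := n + 1) (Φ.psiBall p ψ)
  have h_fourier_le := fourierApproxOn_psiBall_le (Φ := Φ) (p := p) (n := n + 1) hfin hε.le
    fun k hk => norm_le_charEps_succ hψ_lim hk
  have h_le_best := (h_width_ge _ (charDelta_lt_succ hψ_lim hε)).trans h_width_le
  exact ⟨fun m hm hm' => le_antisymm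
      ((h_width_anti hm).trans (h_width_le.trans (h_best_le.trans h_fourier_le)))
      (h_width_ge m hm'),
    le_antisymm (h_best_le.trans h_fourier_le) h_le_best,
    le_antisymm h_fourier_le (h_le_best.trans h_best_le)⟩

theorem theorem2p7 {X : Type*} [AddCommGroup X] [Module ℂ X] (Φ : PhiSystem X)
    (p : ℝ) [Fact (1 ≤ p)] (ψ : ℕ → ℂ)
    (hψ_lim : Tendsto (fun k => ‖ψ k‖) atTop (𝓝 0)) (hψ_ne : ∀ k, ψ k ≠ 0)
    (n : ℕ) (hn : 1 ≤ n) :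
    (∀ m : ℕ, charDelta ψ (n - 1) ≤ m → m < charDelta ψ n →
      kolmogorovWidth (Φ.psiBallS p ψ) m = ENNReal.ofReal (charEps ψ n)) ∧
    Φ.bestApproxOn p ψ n (Φ.psiBall p ψ) = ENNReal.ofReal (charEps ψ n) ∧
    Φ.fourierApproxOn p ψ n (Φ.psiBall p ψ) = ENNReal.ofReal (charEps ψ n) :=
  theorem2p7_general Φ p ψ hψ_lim n (charEps_pos hψ_lim hψ_ne (Nat.one_le_iff_ne_zero.1 hn))
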